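/- Let $X$ be a finite set and $r:X\times X\to X\times X$, $r(x,y)=({}^xy,x^y)$, a nondegenerate, involutive, square-free ($r(x,x)=(x,x)$) set-theoretic solution of the Yang-Baxter equation of multipermutation level $2$. Write $\mathcal L_x(y)={}^xy$, let $\mathcal G\subseteq \mathrm{Sym}(X)$ be the group generated by the $\mathcal L_x$, let $X_1,\dots,X_t$ be the $\mathcal G$-orbits in $X$, let $\mathcal G_i\subseteq\mathrm{Sym}(X_i)$ be the group generated by the restrictions $\mathcal L_x|_{X_i}$ $(x\in X)$, and put $\mathcal G_i^*=\mathrm{Hom}(\mathcal G_i,\mathbb C^\times)$, $\mathcal H=\prod_i\mathcal G_i$, $\mathcal H^*=\prod_i\mathcal G_i^*$ and $H=\mathcal H^*\times\mathcal H$. Characters are evaluated by $\chi(h)=\prod_i\chi_i(h_i)$ for $\chi\in\mathcal H^*$, $h\in\mathcal H$. Let $V=\mathbb CX$ and let $\mathbb C[V]$ be the polynomial algebra in the variables $x\in X$. Grade $V$ by $H$ as follows: $v\in V$ has degree $(\chi,g)$ if $v$ is a linear combination of those $x\in X$ with $\mathcal L_x|_{X_j}=g_j$ for all $j$, and $h\cdot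 v=\chi(h)v$ for all $h\in\mathcal H$, where $\mathcal H$ acts on $V$ by letting $h_i\in\mathcal G_i$ permute $X_i$. Extend the grading multiplicatively to $\mathbb C[V]$. Let $\mathcal F:H\times H\to\mathbb C^\times$, $\mathcal F((\chi,g),(\chi',h))=\chi'(g)$. Then $\mathbb C[V]$ is an $H$-graded algebra, $\mathcal F$ is a 2-cocycle on $H$, and there is exactly one bilinear product $\bullet$ on the vector space $\mathbb C[V]$ with $f\bullet g=\mathcal F(|f|,|g|)\,fg$ for homogeneous $f,g$ (the cotwist $\mathbb C[V]^{\mathcal F}$). This product is associative with unit $1$; in the original basis it satisfies \[ x\bullet y=x\,\mathcal L_x(y)\qquad\text{for all }x,y\in X \] (with the commutative product of $\mathbb C[V]$ on the right); and there is an algebra isomorphism from the Yang-Baxter algebra $\mathcal A(\mathbb C,X,r)=\mathbb C\langle X\mid xy=zt \text{ whenever } r(x,y)=(z,t)\rangle$ onto $(\mathbb C[V],\bullet)$ that sends each generator $x$ to the variable $x$. -/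

import Mathlib

universe u

namespace YangBaxter

/-! ### Quadratic sets and set-theoretic solutions -/

section QuadraticSets

/-- The left action `ℒ_x(y) = ˣy`, where `r (x, y) = (ˣy, xʸ)`. -/
def leftAct {X : Type u} (r : X × X → X × X) (x y : X) : X := (r (x, y)).1

/-- The right action `ℛ_y(x) = xʸ`, where `r (x, y) = (ˣy, xʸ)`. -/
def rightAct {X : Type u} (r : X × X → X × X) (y x : X) : X := (r (x, y)).2

/-- All maps `ℒ_x` and `ℛ_x` are bijective. -/
def Nondegenerate {X : Type u} (r : X × X → X × X) : Prop :=
  ∀ x : X, Function.Bijective (leftAct r x) ∧ Function.Bijective (rightAct r x)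

/-- `r (x, x) = (x, x)` for all `x`. -/
def SquareFree {X : Type u} (r : X × X → X × X) : Prop := ∀ x : X, r (x, x) = (x, x)

/-- `r × id` on `X × X × X`. -/
def r12 {X : Type u} (r : X × X → X × X) (t : X × X × X) : X × X × X :=
  ((r (t.1, t.2.1)).1, (r (t.1, t.2.1)).2, t.2.2)

/-- `id × r` on `X × X × X`. -/
def r23 {X : Type u} (r : X × X → X × X) (t : X × X × X) : X × X × X :=
  (t.1, r (t.2.1, t.2.2))

/-- The set-theoretic Yang-Baxter equation, in the form of the braid relation. -/
def Braided {X : Type u} (r : X × X → X × X) : Prop :=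
  r12 r ∘ r23 r ∘ r12 r = r23 r ∘ r12 r ∘ r23 r

/-- A symmetric set: an involutive (hence bijective) solution of the Yang-Baxter equation. -/
def Symmetric {X : Type u} (r : X × X → X × X) : Prop :=
  Braided r ∧ Function.Involutive r

/-! ### Retraction and multipermutation level -/

/-- The equivalence relation `x ∼ y ↔ ℒ_x = ℒ_y`. -/
def retSetoid {X : Type u} (r : X × X → X × X) : Setoid X := Setoid.ker (leftAct r)

/-- The underlying set `[X] = X / ∼` of the retraction. -/
def Ret {X : Type u} (r : X × X → X × X) : Type u := Quotient (retSetoid r)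

/-- The class `[x]`. -/
def Ret.mk {X : Type u} (r : X × X → X × X) (x : X) : Ret r := Quotient.mk (retSetoid r) x

/-- The induced map `([x], [y]) ↦ ([ˣy], [xʸ])` on `[X]`, computed on chosen representatives. By
`retMap_mk` below, the choice is irrelevant for a nondegenerate symmetric set. -/
noncomputable def retMap {X : Type u} (r : X × X → X × X) (p : Ret r × Ret r) :
    Ret r × Ret r :=
  (Ret.mk r (leftAct r (Quotient.out p.1) (Quotient.out p.2)),
    Ret.mk r (rightAct r (Quotient.out p.2) (Quotient.out p.1)))

theorem leftAct_comp {X : Type u} {r : X × X → X × X} (h : Braided r) (x y z : X) :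
    leftAct r x (leftAct r y z)
      = leftAct r (leftAct r x y) (leftAct r (rightAct r y x) z) := by
  have := congrArg Prod.fst (congrFun h (x, y, z))
  simpa [r12, r23, leftAct, rightAct] using this.symm

theorem leftAct_invol {X : Type u} {r : X × X → X × X} (h : Function.Involutive r) (x y : X) :
    leftAct r (leftAct r x y) (rightAct r y x) = x :=
  congrArg Prod.fst (h (x, y))

/-- In a nondegenerate symmetric set, `ℒ_y = ℒ_z` implies `ℛ_y = ℛ_z`. -/
theorem rightAct_eq_of_leftAct_eq {X : Type u} {r : X × X → X × X} (hn : Nondegenerate r)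
    (hs : Symmetric r) {y z : X} (h : leftAct r y = leftAct r z) :
    rightAct r y = rightAct r z := by
  have hex : ∀ x : X, ∃ t : X, leftAct r x t = x := fun x => (hn x).1.2 x
  choose T hT using hex
  have hTinj : Function.Injective T := by
    intro a b hab
    have key : ∀ x : X, rightAct r (T x) x = T x := by
      intro x
      have h1 := leftAct_invol hs.2 x (T x)
      rw [hT x] at h1
      exact (hn x).1.1 (h1.trans (hT x).symm)
    apply (hn (T a)).2.1
    rw [key a]
    have := key b
    rw [← hab] at this
    exact this.symm
  have hTR : ∀ w x : X, leftAct r w (T (rightAct r w x)) = T x := by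
    intro w x
    apply (hn x).1.1
    rw [leftAct_comp hs.1, hT, hT, leftAct_invol hs.2]
  funext x
  apply hTinj
  apply (hn y).1.1
  rw [hTR y x, h, hTR z x]

theorem leftAct_leftAct_congr {X : Type u} {r : X × X → X × X} (hn : Nondegenerate r)
    (hs : Symmetric r) {x x' y y' : X} (hx : leftAct r x = leftAct r x')
    (hy : leftAct r y = leftAct r y') :
    leftAct r (leftAct r x y) = leftAct r (leftAct r x' y') ∧
      leftAct r (rightAct r y x) = leftAct r (rightAct r y' x') := by
  have hR := rightAct_eq_of_leftAct_eq hn hs hy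
  have hL : ∀ {a a' b b' : X}, leftAct r a = leftAct r a' → leftAct r b = leftAct r b' →
      leftAct r (rightAct r b a) = leftAct r (rightAct r b' a') →
      leftAct r (leftAct r a b) = leftAct r (leftAct r a' b') := by
    intro a a' b b' ha hb hab
    funext z
    obtain ⟨w, rfl⟩ := (hn (rightAct r b a)).1.2 z
    rw [← leftAct_comp hs.1, hab, ← leftAct_comp hs.1, ha, hb]
  have hright : ∀ b : X, leftAct r (rightAct r b x) = leftAct r (rightAct r b x') := by
    intro b
    have e : leftAct r (leftAct r x b) = leftAct r (leftAct r x' b) := by rw [hx]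
    funext z
    apply (hn (leftAct r x b)).1.1
    rw [← leftAct_comp hs.1, e, ← leftAct_comp hs.1, hx]
  have h2 : leftAct r (rightAct r y x) = leftAct r (rightAct r y' x') := by
    rw [hR]; exact hright y'
  exact ⟨hL hx hy h2, h2⟩

theorem retMap_mk {X : Type u} {r : X × X → X × X} (hn : Nondegenerate r) (hs : Symmetric r)
    (x y : X) :
    retMap r (Ret.mk r x, Ret.mk r y)
      = (Ret.mk r (leftAct r x y), Ret.mk r (rightAct r y x)) := by
  have hx : leftAct r (Quotient.out (Ret.mk r x)) = leftAct r x :=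
    Quotient.exact (s := retSetoid r) (Quotient.out_eq (Ret.mk r x))
  have hy : leftAct r (Quotient.out (Ret.mk r y)) = leftAct r y :=
    Quotient.exact (s := retSetoid r) (Quotient.out_eq (Ret.mk r y))
  have := leftAct_leftAct_congr hn hs hx hy
  exact Prod.ext (Quotient.sound (s := retSetoid r) this.1)
    (Quotient.sound (s := retSetoid r) this.2)

/-- The iterated retractions `Ret^m(X, r)`. -/
noncomputable def iterRet {X : Type u} (r : X × X → X × X) :
    ℕ → Σ Y : Type u, (Y × Y → Y × Y)
  | 0 => ⟨X, r⟩
  | m + 1 => ⟨Ret (iterRet r m).2, retMap (iterRet r m).2⟩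

/-- `mpl(X, r) = m`: `m` is minimal such that `Ret^m(X, r)` lives on a set of one element. -/
def HasLevel {X : Type u} (r : X × X → X × X) (m : ℕ) : Prop :=
  IsLeast {m : ℕ | Nonempty (iterRet r m).1 ∧ Subsingleton (iterRet r m).1} m

/-! ### The Yang-Baxter algebra -/

/-- The defining relations `xy = zt` whenever `r (x, y) = (z, t)`. -/
inductive AlgRel (k : Type) [Field k] {X : Type u} (r : X × X → X × X) :
    FreeAlgebra k X → FreeAlgebra k X → Prop
  | mk (x y : X) : AlgRel k r (FreeAlgebra.ι k x * FreeAlgebra.ι k y)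
      (FreeAlgebra.ι k (r (x, y)).1 * FreeAlgebra.ι k (r (x, y)).2)

/-- The algebra `𝒜(k, X, r) = k⟨X ; ℜ(r)⟩`. -/
abbrev Alg (k : Type) [Field k] {X : Type u} (r : X × X → X × X) : Type u :=
  RingQuot (AlgRel k r)

/-- The generator of `𝒜(k, X, r)` labelled by `x`. -/
noncomputable def Alg.gen (k : Type) [Field k] {X : Type u} (r : X × X → X × X) (x : X) :
    Alg k r :=
  RingQuot.mkAlgHom k (AlgRel k r) (FreeAlgebra.ι k x)

end QuadraticSets

/-! ### Group gradings and cotwists -/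

section Cotwists

/-- A (normalised) 2-cocycle on a group with values in `ℂˣ`. -/
def IsTwoCocycle {H : Type u} [Group H] (F : H → H → ℂˣ) : Prop :=
  (∀ a b c : H, F a (b * c) * F b c = F a b * F (a * b) c) ∧ ∀ a : H, F 1 a = 1

/-- The subspaces `𝒜 a` make `A = ⨁ₐ 𝒜 a` an `H`-graded algebra. -/
structure IsGroupGrading {H : Type u} [Group H] {A : Type u} [Ring A] [Algebra ℂ A]
    (𝒜 : H → Submodule ℂ A) : Prop where
  indep : iSupIndep 𝒜
  span : ⨆ a, 𝒜 a = ⊤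
  one_mem : (1 : A) ∈ 𝒜 1
  mul_mem : ∀ (a b : H) (f g : A), f ∈ 𝒜 a → g ∈ 𝒜 b → f * g ∈ 𝒜 (a * b)

/-- The bilinear map `B` is the cotwisted product on the `H`-graded algebra `A`: the bilinear
extension of `f • g = F(|f|, |g|) f g` for homogeneous `f`, `g`. -/
def IsCotwist {H : Type u} [Group H] {A : Type u} [Ring A] [Algebra ℂ A]
    (𝒜 : H → Submodule ℂ A) (F : H → H → ℂˣ) (B : A →ₗ[ℂ] A →ₗ[ℂ] A) : Prop :=
  ∀ (a b : H) (f g : A), f ∈ 𝒜 a → g ∈ 𝒜 b → B f g = (F a b : ℂ) • (f * g)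

end Cotwists

/-! ### The groups attached to a solution, and the canonical cotwist -/

section Canonical

/-- The permutation group `𝒢 = 𝒢(X, r)` generated by the left actions `ℒ_x`. -/
def permGroup {X : Type u} (r : X × X → X × X) : Subgroup (Equiv.Perm X) :=
  Subgroup.closure {g | ∃ x : X, ∀ y : X, g y = leftAct r x y}

/-- The index set `{1, …, t}` of the `𝒢`-orbits in `X`. -/
abbrev Orbits {X : Type u} (r : X × X → X × X) : Type u :=
  MulAction.orbitRel.Quotient (permGroup r) X

/-- The orbit `X_i`, as a subset of `X`. -/
def orbitSet {X : Type u} (r : X × X → X × X) (i : Orbits r) : Set X :=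
  MulAction.orbitRel.Quotient.orbit i

/-- The index `i` of the orbit containing `x`. -/
def orbitOf {X : Type u} (r : X × X → X × X) (x : X) : Orbits r := Quotient.mk'' x

theorem mem_orbitSet_orbitOf {X : Type u} (r : X × X → X × X) (x : X) :
    x ∈ orbitSet r (orbitOf r x) :=
  MulAction.orbitRel.Quotient.mem_orbit.2 rfl

/-- The group `𝒢_i` of permutations of `X_i` generated by the restrictions of the `ℒ_x`, `x ∈ X`. -/
def orbitGroup {X : Type u} (r : X × X → X × X) (i : Orbits r) :
    Subgroup (Equiv.Perm (orbitSet r i)) :=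
  Subgroup.closure {g | ∃ x : X, ∀ y : orbitSet r i, (g y : X) = leftAct r x y}

/-- `ℋ = ∏_i 𝒢_i`. -/
abbrev HGroup {X : Type u} (r : X × X → X × X) : Type u :=
  ∀ i : Orbits r, orbitGroup r i

/-- `ℋ* = ∏_i 𝒢_i*`, where `𝒢_i*` is the group of characters `𝒢_i → ℂˣ`. -/
abbrev HDual {X : Type u} (r : X × X → X × X) : Type u :=
  ∀ i : Orbits r, (orbitGroup r i →* ℂˣ)

/-- `H = ℋ* × ℋ`. -/
abbrev GradingGroup {X : Type u} (r : X × X → X × X) : Type u := HDual r × HGroup r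

/-- The evaluation `χ(h) = ∏_i χ_i(h_i)` of a character `χ ∈ ℋ*` at `h ∈ ℋ`. -/
noncomputable def pairing {X : Type u} (r : X × X → X × X) (χ : HDual r) (h : HGroup r) : ℂˣ :=
  ∏ᶠ i : Orbits r, χ i (h i)

/-- The canonical 2-cocycle `ℱ((χ, g), (χ', h)) = χ'(g)` on `H`. -/
noncomputable def cocycle {X : Type u} (r : X × X → X × X) (a b : GradingGroup r) : ℂˣ :=
  pairing r b.1 a.2

/-- The action of `ℋ` on `X`: the component `h_i` acts on `X_i`. -/
def hAct {X : Type u} (r : X × X → X × X) (h : HGroup r) (x : X) : X :=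
  ((h (orbitOf r x) : Equiv.Perm (orbitSet r (orbitOf r x)))
    ⟨x, mem_orbitSet_orbitOf r x⟩ : orbitSet r (orbitOf r x))

/-- `x ∈ X_i` has `ℋ`-degree `g`, that is, `g = γ^i = ∏_j σ^i_j`, where `σ^i_j ∈ 𝒢_j` is the
restriction of `ℒ_x` to `X_j`. -/
def HasHDegree {X : Type u} (r : X × X → X × X) (x : X) (g : HGroup r) : Prop :=
  ∀ (j : Orbits r) (y : orbitSet r j),
    (((g j : Equiv.Perm (orbitSet r j)) y : orbitSet r j) : X) = leftAct r x y

/-- The homogeneous component of degree `(χ, g) ∈ H` of `V = ℂX`: the vectors of `ℋ`-degree `g`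
on which `ℋ` acts through the character `χ`. -/
def vComponent {X : Type u} (r : X × X → X × X) (a : GradingGroup r) : Set (X →₀ ℂ) :=
  {v | v ∈ Submodule.span ℂ {w | ∃ x : X, HasHDegree r x a.2 ∧ w = Finsupp.single x (1 : ℂ)} ∧
    ∀ h : HGroup r, Finsupp.lmapDomain ℂ ℂ (hAct r h) v = (pairing r a.1 h : ℂ) • v}

/-- The inclusion of `V = ℂX` in `ℂ[V]` as the linear forms. -/
noncomputable def linForm {X : Type u} : (X →₀ ℂ) →ₗ[ℂ] MvPolynomial X ℂ :=
  Finsupp.linearCombination ℂ (fun x : X => (MvPolynomial.X x : MvPolynomial X ℂ))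

/-- `f` is a product of homogeneous elements of `V`, and `a` is the product of their degrees. -/
inductive IsHomogProd {X : Type u} (r : X × X → X × X) :
    GradingGroup r → MvPolynomial X ℂ → Prop
  | one : IsHomogProd r 1 1
  | mul (a b : GradingGroup r) (v : X →₀ ℂ) (f : MvPolynomial X ℂ) :
      v ∈ vComponent r a → IsHomogProd r b f → IsHomogProd r (a * b) (linForm v * f)

/-- The homogeneous components of `ℂ[V]` in the `H`-grading extended multiplicatively from `V`. -/
noncomputable def component {X : Type u} (r : X × X → X × X) (a : GradingGroup r) :
    Submodule ℂ (MvPolynomial X ℂ) :=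
  Submodule.span ℂ {f | IsHomogProd r a f}

end Canonical

end YangBaxter

/-! At level two, square-freeness makes `ℒ` constant on the `𝒢`-orbits. Hence the `ℒ_x` commute, and
involutivity forces `r (x, y) = (ℒ_x y, ℒ_y⁻¹ x)`. So the abelian group `ℋ` acts on `X`, and `γ x =
(ℒ_x restricted to each orbit)` is an `ℋ`-invariant map `X → ℋ`; this is all the algebra below uses.

Let `ρ_h` be the automorphism of `ℂ[V]` permuting the variables by `h`. If `|f| = (χ, g)` and `|f'|
= (χ', g')`, then `ρ_g f' = χ'(g) f'`, so the cotwisted product is `f • f' = f · ρ_g f'`. This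
formula needs only the `ℋ`-degree of `f`, which monomials have. The product is therefore built
directly on monomials (`cotwistMul`), and the characters are needed only to identify it with the
cotwist.

For the grading, every `x` is a multiple of a sum of isotypic vectors by orthogonality of characters
(`sum_isotypicVector`). Independence holds because the components lie in distinct joint eigenspaces
of the commuting operators `ρ_h` and the projections to a fixed `ℋ`-degree (`iSupIndep_component`).

For the isomorphism, the Yang-Baxter algebra acts on `ℂ[V]` by left cotwisted multiplications, and
acting on `1` sends a word to a monomial. Every monomial arises (`exists_wordVal_eq`), and words
with the same monomial are already equal in the algebra (`prod_eq_of_wordVal_eq`). -/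

namespace YangBaxter

/-! ### Cotwists of polynomial algebras by a group acting on the variables -/

section PolynomialCotwist

variable {k : Type*} [CommRing k] {X : Type*}

/-- The monomial attached to a multiset of variables. -/
noncomputable def mon (k : Type*) [CommRing k] {X : Type*} (s : Multiset X) : MvPolynomial X k :=
  (s.map MvPolynomial.X).prod

@[simp] lemma mon_zero : mon k (0 : Multiset X) = 1 := by simp [mon]

@[simp] lemma mon_singleton (x : X) : mon k {x} = MvPolynomial.X x := by simp [mon]

lemma mon_cons (x : X) (s : Multiset X) : mon k (x ::ₘ s) = MvPolynomial.X x * mon k s := by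
  simp [mon]

lemma mon_add (s t : Multiset X) : mon k (s + t) = mon k s * mon k t := by
  simp [mon]

lemma mon_eq_monomial [DecidableEq X] (s : Multiset X) :
    mon k s = MvPolynomial.monomial (Multiset.toFinsupp s) 1 := by
  induction s using Multiset.induction_on with
  | empty => simp
  | cons x s ih =>
    rw [mon_cons, ih, ← Multiset.singleton_add, Multiset.toFinsupp_add,
      Multiset.toFinsupp_singleton, MvPolynomial.X, MvPolynomial.monomial_mul, one_mul]

open Classical in
/-- The basis of monomials, indexed by multisets of variables. -/
noncomputable def monBasis (k : Type*) [CommRing k] (X : Type*) :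
    Module.Basis (Multiset X) k (MvPolynomial X k) :=
  (MvPolynomial.basisMonomials X k).reindex Multiset.toFinsupp.symm.toEquiv

lemma monBasis_apply (s : Multiset X) : monBasis k X s = mon k s := by
  classical
  rw [mon_eq_monomial]
  simp only [monBasis, Module.Basis.reindex_apply, MvPolynomial.coe_basisMonomials]
  congr!

lemma hom_ext_mon {M : Type*} [AddCommMonoid M] [Module k M] {f g : MvPolynomial X k →ₗ[k] M}
    (h : ∀ s, f (mon k s) = g (mon k s)) : f = g :=
  (monBasis k X).ext fun s => by rw [monBasis_apply, h]

lemma span_range_mon : Submodule.span k (Set.range (mon k : Multiset X → MvPolynomial X k)) = ⊤ := by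
  rw [← (monBasis k X).span_eq]
  congr 2
  exact funext fun s => (monBasis_apply s).symm

variable {G : Type*} [CommGroup G]

/-- The multiplicative extension of a `G`-valued degree from variables to monomials. -/
def monDeg (γ : X → G) (s : Multiset X) : G := (s.map γ).prod

@[simp] lemma monDeg_zero (γ : X → G) : monDeg γ 0 = 1 := by simp [monDeg]

@[simp] lemma monDeg_singleton (γ : X → G) (x : X) : monDeg γ {x} = γ x := by simp [monDeg]

@[simp] lemma monDeg_add (γ : X → G) (s t : Multiset X) :
    monDeg γ (s + t) = monDeg γ s * monDeg γ t := by simp [monDeg]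

/-- The polynomials spanned by the monomials of degree `g`. -/
noncomputable def degSpan (k : Type*) [CommRing k] {X G : Type*} [CommGroup G] (γ : X → G) (g : G) :
    Submodule k (MvPolynomial X k) :=
  Submodule.span k (mon k '' {s | monDeg γ s = g})

lemma one_mem_degSpan (γ : X → G) : (1 : MvPolynomial X k) ∈ degSpan k γ 1 :=
  Submodule.subset_span ⟨0, monDeg_zero γ, mon_zero⟩

lemma mul_mem_degSpan (γ : X → G) {a b : G} {f g : MvPolynomial X k} (hf : f ∈ degSpan k γ a)
    (hg : g ∈ degSpan k γ b) : f * g ∈ degSpan k γ (a * b) := by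
  have h := Submodule.mul_mem_mul hf hg
  rw [degSpan, degSpan, Submodule.span_mul_span] at h
  refine Submodule.span_mono ?_ h
  rintro _ ⟨_, ⟨s, hs, rfl⟩, _, ⟨t, ht, rfl⟩, rfl⟩
  exact ⟨s + t, (monDeg_add γ s t).trans (congrArg₂ _ hs ht), mon_add s t⟩

open Classical in
/-- The projection onto the polynomials of degree `g`. -/
noncomputable def degProj (k : Type*) [CommRing k] {X G : Type*} [CommGroup G] (γ : X → G)
    (g : G) : Module.End k (MvPolynomial X k) :=
  (monBasis k X).constr k fun s => if monDeg γ s = g then mon k s else 0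

open Classical in
lemma degProj_mon (γ : X → G) (g : G) (s : Multiset X) :
    degProj k γ g (mon k s) = if monDeg γ s = g then mon k s else 0 := by
  rw [degProj, ← monBasis_apply, Module.Basis.constr_basis, monBasis_apply]

-- Turns the `G`-degree into eigenvalues `0` and `1`, so that it can be handled together with the
-- eigenvalues of `permVars`.
open Classical in
lemma degProj_of_mem_degSpan {γ : X → G} {a : G} (g : G) {f : MvPolynomial X k}
    (hf : f ∈ degSpan k γ a) : degProj k γ g f = (if a = g then (1 : k) else 0) • f := by
  induction hf using Submodule.span_induction with
  | zero => simp
  | add f f' _ _ h h' => rw [map_add, h, h', smul_add]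
  | smul c f _ h => rw [map_smul, h, smul_comm]
  | mem f hf =>
    obtain ⟨s, rfl, rfl⟩ := hf
    rw [degProj_mon, ite_smul, one_smul, zero_smul]

lemma commute_degProj (γ : X → G) (g h : G) : Commute (degProj k γ g) (degProj k γ h) := by
  classical
  refine hom_ext_mon fun s => ?_
  simp only [Module.End.mul_apply, degProj_mon, apply_ite, map_zero]
  split_ifs <;> rfl

variable [MulAction G X]

/-- The automorphism of the polynomial algebra that permutes the variables by `g`. -/
noncomputable def permVars (k : Type*) [CommRing k] {X G : Type*} [CommGroup G] [MulAction G X]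
    (g : G) : MvPolynomial X k →ₐ[k] MvPolynomial X k :=
  MvPolynomial.rename (g • ·)

@[simp] lemma permVars_X (g : G) (x : X) :
    permVars k g (MvPolynomial.X x) = MvPolynomial.X (g • x) := by
  simp [permVars]

@[simp] lemma permVars_mon (g : G) (s : Multiset X) :
    permVars k g (mon k s) = mon k (s.map (g • ·)) := by
  simp [mon, map_multiset_prod]

lemma permVars_mul (g h : G) (f : MvPolynomial X k) :
    permVars k (g * h) f = permVars k g (permVars k h f) := by
  simp only [permVars, MvPolynomial.rename_rename]
  congr 2
  exact funext fun x => mul_smul g h x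

@[simp] lemma permVars_one (f : MvPolynomial X k) : permVars k (1 : G) f = f := by
  simp only [permVars, one_smul]
  exact MvPolynomial.rename_id_apply f

lemma monDeg_map {γ : X → G} (hγ : ∀ (g : G) x, γ (g • x) = γ x) (g : G) (s : Multiset X) :
    monDeg γ (s.map (g • ·)) = monDeg γ s := by
  simp [monDeg, Multiset.map_map, hγ]

/-- The product `m • f = m · ρ_{deg m}(f)`, for `m` a monomial. -/
noncomputable def cotwistMul (k : Type*) [CommRing k] {X G : Type*} [CommGroup G] [MulAction G X]
    (γ : X → G) : MvPolynomial X k →ₗ[k] MvPolynomial X k →ₗ[k] MvPolynomial X k :=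
  (monBasis k X).constr k fun s =>
    LinearMap.mulLeft k (mon k s) ∘ₗ (permVars k (monDeg γ s)).toLinearMap

lemma cotwistMul_mon (γ : X → G) (s : Multiset X) (f : MvPolynomial X k) :
    cotwistMul k γ (mon k s) f = mon k s * permVars k (monDeg γ s) f := by
  rw [cotwistMul, ← monBasis_apply, Module.Basis.constr_basis]
  simp [monBasis_apply]

lemma cotwistMul_X (γ : X → G) (x : X) (f : MvPolynomial X k) :
    cotwistMul k γ (MvPolynomial.X x) f = MvPolynomial.X x * permVars k (γ x) f := by
  simpa using cotwistMul_mon (k := k) γ {x} f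

lemma cotwistMul_mon_mon (γ : X → G) (s t : Multiset X) :
    cotwistMul k γ (mon k s) (mon k t) = mon k (s + t.map (monDeg γ s • ·)) := by
  rw [cotwistMul_mon, permVars_mon, mon_add]

/-- For monomials `s`, `t` both sides are `s · ρ_{deg s}(t) · ρ_{deg s · deg t}(h)`, because
permuting variables by `G` preserves degrees. -/
lemma cotwistMul_assoc {γ : X → G} (hγ : ∀ (g : G) x, γ (g • x) = γ x)
    (f g h : MvPolynomial X k) :
    cotwistMul k γ (cotwistMul k γ f g) h = cotwistMul k γ f (cotwistMul k γ g h) := by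
  have hf : f ∈ Submodule.span k (Set.range (mon k : Multiset X → MvPolynomial X k)) := by
    simp [span_range_mon]
  have hg : g ∈ Submodule.span k (Set.range (mon k : Multiset X → MvPolynomial X k)) := by
    simp [span_range_mon]
  induction hf using Submodule.span_induction with
  | zero => simp
  | add f f' _ _ h h' => simp [h, h']
  | smul c f _ h => simp [h]
  | mem f hf =>
    obtain ⟨s, rfl⟩ := hf
    induction hg using Submodule.span_induction with
    | zero => simp
    | add f f' _ _ h h' => simp [h, h']
    | smul c f _ h => simp [h]
    | mem g hg =>
      obtain ⟨t, rfl⟩ := hg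
      rw [cotwistMul_mon_mon, cotwistMul_mon, cotwistMul_mon, cotwistMul_mon, monDeg_add,
        monDeg_map hγ, permVars_mul, map_mul, permVars_mon, mon_add, mul_assoc]

lemma cotwistMul_one_left (γ : X → G) (f : MvPolynomial X k) : cotwistMul k γ 1 f = f := by
  simpa using cotwistMul_mon (k := k) γ 0 f

lemma cotwistMul_one_right (γ : X → G) (f : MvPolynomial X k) : cotwistMul k γ f 1 = f := by
  have : (cotwistMul k γ).flip 1 = LinearMap.id :=
    hom_ext_mon fun s => by simp [cotwistMul_mon]
  exact LinearMap.congr_fun this f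

lemma cotwistMul_of_mem_degSpan {γ : X → G} {a : G} {f : MvPolynomial X k}
    (hf : f ∈ degSpan k γ a) (g : MvPolynomial X k) :
    cotwistMul k γ f g = f * permVars k a g := by
  induction hf using Submodule.span_induction with
  | zero => simp
  | add f f' _ _ h h' => simp [h, h', add_mul]
  | smul c f _ h => simp [h]
  | mem f hf =>
    obtain ⟨s, rfl, rfl⟩ := hf
    exact cotwistMul_mon γ s g

lemma commute_permVars (g h : G) :
    Commute (permVars k g : MvPolynomial X k →ₐ[k] _).toLinearMap (permVars k h).toLinearMap :=
  LinearMap.ext fun f => by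
    simp [Module.End.mul_apply, ← permVars_mul, mul_comm]

lemma commute_permVars_degProj {γ : X → G} (hγ : ∀ (g : G) x, γ (g • x) = γ x) (g h : G) :
    Commute (permVars k g).toLinearMap (degProj k γ h) := by
  classical
  refine hom_ext_mon fun s => ?_
  simp only [Module.End.mul_apply, degProj_mon, AlgHom.toLinearMap_apply, permVars_mon,
    monDeg_map hγ, apply_ite, map_zero]
  split_ifs <;> rfl

end PolynomialCotwist

/-- Simultaneous eigenspaces of commuting endomorphisms are independent. -/
lemma iSupIndep_of_commuting_eigenvectors {K M ι α : Type*} [Field K] [AddCommGroup M]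
    [Module K M] (T : ι → Module.End K M) (hT : ∀ i j, Commute (T i) (T j))
    (c : α → ι → K) (hc : Function.Injective c) (W : α → Submodule K M)
    (hW : ∀ a, ∀ v ∈ W a, ∀ i, T i v = c a i • v) : iSupIndep W := by
  have h := Module.End.independent_iInf_maxGenEigenspace_of_forall_mapsTo T fun i j φ =>
    Module.End.mapsTo_maxGenEigenspace_of_comm (hT j i) φ
  -- `h` covers all systems of eigenvalues; injectivity of `c` selects those that occur.
  refine (h.comp hc).mono fun a v hv => ?_
  simp only [Function.comp_apply, Submodule.mem_iInf]
  intro i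
  refine Module.End.mem_maxGenEigenspace _ _ _ |>.2 ⟨1, ?_⟩
  simp [hW a v hv i]

/-- Orthogonality of the characters of a finite commutative group. -/
lemma sum_characters_apply {G : Type*} [CommGroup G] [Finite G] [Fintype (G →* ℂˣ)]
    [DecidableEq G] (a : G) :
    ∑ φ : G →* ℂˣ, (φ a : ℂ) = if a = 1 then (Fintype.card (G →* ℂˣ) : ℂ) else 0 := by
  split_ifs with h
  · simp [h]
  · obtain ⟨ψ, hψ⟩ := CommGroup.exists_apply_ne_one_of_hasEnoughRootsOfUnity G ℂ h
    have key : (ψ a : ℂ) * ∑ φ : G →* ℂˣ, (φ a : ℂ) = ∑ φ : G →* ℂˣ, (φ a : ℂ) := by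
      rw [Finset.mul_sum]
      exact Fintype.sum_equiv (Equiv.mulLeft ψ) _ _ fun φ => by simp
    have h1 : ((ψ a : ℂ) - 1) * ∑ φ : G →* ℂˣ, (φ a : ℂ) = 0 := by rw [sub_mul, key]; ring
    refine (mul_eq_zero.1 h1).resolve_left fun h0 => hψ ?_
    exact Units.ext (sub_eq_zero.1 h0)

end YangBaxter

namespace YangBaxter

/-! ### Words and their normal forms -/

section Words

variable {X G : Type*} [CommGroup G] [MulAction G X]

/-- The monomial `x₁ • (x₂ • (⋯ • xₙ))` for the cotwisted product. -/
def wordVal (γ : X → G) : List X → Multiset X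
  | [] => 0
  | x :: l => x ::ₘ (wordVal γ l).map (γ x • ·)

lemma map_smul_map_smul (g h : G) (s : Multiset X) :
    (s.map (h • ·)).map (g • ·) = s.map ((g * h) • ·) := by
  simp [Multiset.map_map, mul_smul]

lemma map_smul_one (s : Multiset X) : s.map ((1 : G) • ·) = s := by simp

@[simp] lemma card_wordVal (γ : X → G) (l : List X) : (wordVal γ l).card = l.length := by
  induction l with
  | nil => simp [wordVal]
  | cons x l ih => simp [wordVal, ih]

/-- Any variable `x` of `s` may come first: untwist the remaining ones by `(γ x)⁻¹` and recurse. -/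
lemma exists_wordVal_eq (γ : X → G) (s : Multiset X) : ∃ l, wordVal γ l = s := by
  induction h : s.card generalizing s with
  | zero => exact ⟨[], (Multiset.card_eq_zero.1 h).symm⟩
  | succ n ih =>
    obtain ⟨x, hx⟩ := Multiset.card_pos_iff_exists_mem.1 (h.symm ▸ n.succ_pos : 0 < s.card)
    obtain ⟨t, rfl⟩ := Multiset.exists_cons_of_mem hx
    obtain ⟨l, hl⟩ := ih (t.map ((γ x)⁻¹ • ·)) (by simpa using h)
    refine ⟨x :: l, ?_⟩
    rw [wordVal, hl, map_smul_map_smul, mul_inv_cancel, map_smul_one]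

/-- Words with the same normal form are equal in every monoid satisfying the relations
`x y = (γ x • y) ((γ y)⁻¹ • x)`. -/
lemma prod_eq_of_wordVal_eq {A : Type*} [Monoid A] {γ : X → G}
    (hγ : ∀ (g : G) x, γ (g • x) = γ x) (e : X → A)
    (he : ∀ x y, e x * e y = e (γ x • y) * e ((γ y)⁻¹ • x)) {l l' : List X}
    (h : wordVal γ l = wordVal γ l') : (l.map e).prod = (l'.map e).prod := by
  induction hn : l.length generalizing l l' with
  | zero =>
    have h' := congrArg Multiset.card h
    rw [card_wordVal, card_wordVal, hn] at h'
    rw [List.length_eq_zero_iff.1 hn, List.length_eq_zero_iff.1 h'.symm]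
  | succ n ih =>
    have h' := congrArg Multiset.card h
    rw [card_wordVal, card_wordVal, hn] at h'
    obtain ⟨x, w, rfl⟩ := List.exists_cons_of_length_eq_add_one hn
    obtain ⟨y, u, rfl⟩ := List.exists_cons_of_length_eq_add_one h'.symm
    have hw : w.length = n := by simpa using hn
    have hu : u.length = n := by simpa using h'.symm
    rw [wordVal, wordVal, Multiset.cons_eq_cons] at h
    rw [List.map_cons, List.prod_cons, List.map_cons, List.prod_cons]
    obtain ⟨rfl, h⟩ | ⟨-, s, hs, ht⟩ := h
    · rw [ih (Multiset.map_injective (MulAction.injective (γ x)) h) hw]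
    -- The common monomial is `x y s`. With `v` representing `s` untwisted by both `γ x` and `γ y`,
    -- induction replaces the two tails by `((γ x)⁻¹ • y) v` and `((γ y)⁻¹ • x) v`; one defining
    -- relation then exchanges the first two letters.
    · obtain ⟨v, hv⟩ := exists_wordVal_eq γ (s.map (((γ y)⁻¹ * (γ x)⁻¹) • ·))
      have h1 : wordVal γ w = wordVal γ (((γ x)⁻¹ • y) :: v) := by
        have := congrArg (Multiset.map ((γ x)⁻¹ • ·)) hs
        rw [map_smul_map_smul, inv_mul_cancel, map_smul_one, Multiset.map_cons] at this
        rw [this, wordVal, hγ, hv, map_smul_map_smul, mul_inv_cancel_left]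
      have h2 : wordVal γ u = wordVal γ (((γ y)⁻¹ • x) :: v) := by
        have := congrArg (Multiset.map ((γ y)⁻¹ • ·)) ht
        rw [map_smul_map_smul, inv_mul_cancel, map_smul_one, Multiset.map_cons] at this
        rw [this, wordVal, hγ, hv, map_smul_map_smul, mul_comm (γ y)⁻¹, mul_inv_cancel_left]
      rw [ih h1 hw, ih h2 hu, List.map_cons, List.prod_cons, List.map_cons, List.prod_cons,
        ← mul_assoc, ← mul_assoc, he, hγ, smul_inv_smul]

end Words

/-! ### The Yang-Baxter algebra as a cotwisted polynomial algebra -/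

section AlgebraIso

variable {k : Type} [Field k] {X : Type u} {r : X × X → X × X}

lemma Alg.gen_mul_gen (x y : X) :
    Alg.gen k r x * Alg.gen k r y = Alg.gen k r (r (x, y)).1 * Alg.gen k r (r (x, y)).2 := by
  simp only [Alg.gen, ← map_mul]
  exact RingQuot.mkAlgHom_rel k (AlgRel.mk x y)

/-- The class of a word in the Yang-Baxter algebra. -/
noncomputable def Alg.word (k : Type) [Field k] {X : Type u} (r : X × X → X × X) (l : List X) :
    Alg k r :=
  (l.map (Alg.gen k r)).prod

lemma Alg.span_word : Submodule.span k (Set.range (Alg.word k r)) = ⊤ := by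
  rw [eq_top_iff]
  rintro a -
  obtain ⟨p, rfl⟩ := RingQuot.mkAlgHom_surjective k (AlgRel k r) a
  -- Stability of the span under left multiplication passes to products `p * q`, whereas membership
  -- alone would not.
  suffices H : ∀ b ∈ Submodule.span k (Set.range (Alg.word k r)),
      RingQuot.mkAlgHom k (AlgRel k r) p * b ∈ Submodule.span k (Set.range (Alg.word k r)) by
    simpa using H 1 (Submodule.subset_span ⟨[], by simp [Alg.word]⟩)
  induction p using FreeAlgebra.induction with
  | grade0 c =>
    intro b hb
    rw [AlgHom.commutes, ← Algebra.smul_def]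
    exact Submodule.smul_mem _ c hb
  | grade1 x =>
    intro b hb
    induction hb using Submodule.span_induction with
    | zero => simp
    | add b b' _ _ h h' => rw [mul_add]; exact add_mem h h'
    | smul c b _ h => rw [mul_smul_comm]; exact Submodule.smul_mem _ c h
    | mem b hb =>
      obtain ⟨l, rfl⟩ := hb
      exact Submodule.subset_span ⟨x :: l, by simp [Alg.word, Alg.gen]⟩
  | mul p q hp hq =>
    intro b hb
    rw [map_mul, mul_assoc]
    exact hp _ (hq _ hb)
  | add p q hp hq =>
    intro b hb
    rw [map_add, add_mul]
    exact add_mem (hp _ hb) (hq _ hb)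

variable {G : Type*} [CommGroup G] [MulAction G X] {γ : X → G}

/-- The Yang-Baxter algebra of `r (x, y) = (γ x • y, (γ y)⁻¹ • x)` acting on polynomials by
cotwisted left multiplications. -/
noncomputable def Alg.toEnd (hγ : ∀ (g : G) x, γ (g • x) = γ x)
    (hr : ∀ x y, r (x, y) = (γ x • y, (γ y)⁻¹ • x)) :
    Alg k r →ₐ[k] Module.End k (MvPolynomial X k) :=
  RingQuot.liftAlgHom k ⟨FreeAlgebra.lift k fun x => cotwistMul k γ (MvPolynomial.X x), by
    rintro _ _ ⟨x, y⟩
    refine LinearMap.ext fun f => ?_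
    -- Both sides are `x · (γ x • y) · ρ_{γ x γ y}(f)`.
    simp only [map_mul, FreeAlgebra.lift_ι_apply, Module.End.mul_apply, hr, cotwistMul_X, hγ,
      permVars_X, smul_inv_smul, ← permVars_mul, mul_comm (γ y)]
    ring⟩

lemma Alg.toEnd_gen (hγ : ∀ (g : G) x, γ (g • x) = γ x)
    (hr : ∀ x y, r (x, y) = (γ x • y, (γ y)⁻¹ • x)) (x : X) :
    Alg.toEnd hγ hr (Alg.gen k r x) = cotwistMul k γ (MvPolynomial.X x) := by
  simp [Alg.toEnd, Alg.gen]

lemma Alg.toEnd_word (hγ : ∀ (g : G) x, γ (g • x) = γ x)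
    (hr : ∀ x y, r (x, y) = (γ x • y, (γ y)⁻¹ • x)) (l : List X) :
    Alg.toEnd hγ hr (Alg.word k r l) = cotwistMul k γ (mon k (wordVal γ l)) := by
  induction l with
  | nil =>
    refine LinearMap.ext fun f => ?_
    simp [Alg.word, wordVal, cotwistMul_one_left]
  | cons x l ih =>
    refine LinearMap.ext fun f => ?_
    have h : Alg.word k r (x :: l) = Alg.gen k r x * Alg.word k r l := by simp [Alg.word]
    rw [h, map_mul, ih, Alg.toEnd_gen, Module.End.mul_apply, ← cotwistMul_assoc hγ, wordVal,
      cotwistMul_X, permVars_mon, mon_cons]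

/-- The linear map from the Yang-Baxter algebra to polynomials given by acting on `1`. -/
noncomputable def Alg.toPoly (hγ : ∀ (g : G) x, γ (g • x) = γ x)
    (hr : ∀ x y, r (x, y) = (γ x • y, (γ y)⁻¹ • x)) : Alg k r →ₗ[k] MvPolynomial X k :=
  LinearMap.applyₗ 1 ∘ₗ (Alg.toEnd hγ hr).toLinearMap

lemma Alg.toPoly_apply (hγ : ∀ (g : G) x, γ (g • x) = γ x)
    (hr : ∀ x y, r (x, y) = (γ x • y, (γ y)⁻¹ • x)) (a : Alg k r) :
    Alg.toPoly hγ hr a = Alg.toEnd hγ hr a 1 := rfl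

lemma Alg.toPoly_word (hγ : ∀ (g : G) x, γ (g • x) = γ x)
    (hr : ∀ x y, r (x, y) = (γ x • y, (γ y)⁻¹ • x)) (l : List X) :
    Alg.toPoly hγ hr (Alg.word k r l) = mon k (wordVal γ l) := by
  rw [Alg.toPoly_apply, Alg.toEnd_word, cotwistMul_one_right]

/-- Words span, and each acts as left multiplication by its monomial. This makes acting on `1`
multiplicative for `•`. -/
lemma Alg.toEnd_eq (hγ : ∀ (g : G) x, γ (g • x) = γ x)
    (hr : ∀ x y, r (x, y) = (γ x • y, (γ y)⁻¹ • x)) (a : Alg k r) :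
    Alg.toEnd hγ hr a = cotwistMul k γ (Alg.toPoly hγ hr a) := by
  have h : (Alg.toEnd hγ hr).toLinearMap = cotwistMul k γ ∘ₗ Alg.toPoly (k := k) hγ hr := by
    refine LinearMap.ext_on Alg.span_word ?_
    rintro _ ⟨l, rfl⟩
    simp only [AlgHom.toLinearMap_apply, LinearMap.comp_apply, Alg.toEnd_word, Alg.toPoly_word]
  exact LinearMap.congr_fun h a

lemma Alg.toPoly_mul (hγ : ∀ (g : G) x, γ (g • x) = γ x)
    (hr : ∀ x y, r (x, y) = (γ x • y, (γ y)⁻¹ • x)) (a b : Alg k r) :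
    Alg.toPoly hγ hr (a * b)
      = cotwistMul k γ (Alg.toPoly hγ hr a) (Alg.toPoly hγ hr b) := by
  rw [← Alg.toEnd_eq, Alg.toPoly_apply, map_mul, Module.End.mul_apply, Alg.toPoly_apply]

/-- The inverse of `Alg.toPoly`, sending a monomial to a word representing it. -/
noncomputable def Alg.ofPoly (r : X × X → X × X) (γ : X → G) :
    MvPolynomial X k →ₗ[k] Alg k r :=
  (monBasis k X).constr k fun s => Alg.word k r (exists_wordVal_eq γ s).choose

lemma Alg.ofPoly_mon (s : Multiset X) :
    Alg.ofPoly r γ (mon k s) = Alg.word k r (exists_wordVal_eq γ s).choose := by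
  rw [Alg.ofPoly, ← monBasis_apply, Module.Basis.constr_basis]

/-- The Yang-Baxter algebra of `r (x, y) = (γ x • y, (γ y)⁻¹ • x)` is linearly isomorphic to the
polynomial algebra. -/
noncomputable def Alg.polyEquiv (hγ : ∀ (g : G) x, γ (g • x) = γ x)
    (hr : ∀ x y, r (x, y) = (γ x • y, (γ y)⁻¹ • x)) : Alg k r ≃ₗ[k] MvPolynomial X k :=
  LinearEquiv.ofLinearMap (Alg.toPoly hγ hr) (Alg.ofPoly r γ)
    (hom_ext_mon fun s => by
      rw [LinearMap.comp_apply, Alg.ofPoly_mon, Alg.toPoly_word,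
        (exists_wordVal_eq γ s).choose_spec, LinearMap.id_apply])
    (LinearMap.ext_on Alg.span_word (by
      rintro _ ⟨l, rfl⟩
      rw [LinearMap.comp_apply, Alg.toPoly_word, Alg.ofPoly_mon, LinearMap.id_apply]
      refine prod_eq_of_wordVal_eq hγ _ (fun x y => ?_) (exists_wordVal_eq γ _).choose_spec
      rw [Alg.gen_mul_gen, hr]))

lemma Alg.polyEquiv_apply (hγ : ∀ (g : G) x, γ (g • x) = γ x)
    (hr : ∀ x y, r (x, y) = (γ x • y, (γ y)⁻¹ • x)) (a : Alg k r) :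
    Alg.polyEquiv hγ hr a = Alg.toPoly hγ hr a := rfl

end AlgebraIso

end YangBaxter

namespace YangBaxter

/-! ### Square-free solutions of multipermutation level two -/

section LevelTwo

variable {X : Type u} {r : X × X → X × X}

/-- In a square-free solution of multipermutation level `2`, `ℒ` is constant on orbits. -/
lemma leftAct_leftAct_of_hasLevel (hn : Nondegenerate r) (hq : SquareFree r) (hs : Symmetric r)
    (hl : HasLevel r 2) (x y : X) : leftAct r (leftAct r x y) = leftAct r y := by
  have hsub : Subsingleton (Ret (retMap r)) := hl.1.2
  -- The second retraction is a point, so `[x]` and `[y]` act alike on `[X]`; evaluating at `[y]`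
  -- and using `ʸy = y` finishes.
  have h : leftAct (retMap r) (Ret.mk r x) = leftAct (retMap r) (Ret.mk r y) :=
    Quotient.exact (s := retSetoid (retMap r))
      (Subsingleton.elim (Ret.mk (retMap r) (Ret.mk r x)) (Ret.mk (retMap r) (Ret.mk r y)))
  have h' := congrFun h (Ret.mk r y)
  simp only [leftAct, retMap_mk hn hs] at h'
  have h2 : leftAct r (leftAct r x y) = leftAct r (leftAct r y y) :=
    Quotient.exact (s := retSetoid r) h'
  rwa [show leftAct r y y = y from congrArg Prod.fst (hq y)] at h2

/-- The permutation `ℒ_x`. -/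
noncomputable def leftPerm (hn : Nondegenerate r) (x : X) : Equiv.Perm X :=
  Equiv.ofBijective _ (hn x).1

@[simp] lemma leftPerm_apply (hn : Nondegenerate r) (x y : X) :
    leftPerm hn x y = leftAct r x y := rfl

lemma leftPerm_mem (hn : Nondegenerate r) (x : X) : leftPerm hn x ∈ permGroup r :=
  Subgroup.subset_closure ⟨x, fun _ => rfl⟩

lemma orbitOf_eq_of_mem {i : Orbits r} {x : X} (hx : x ∈ orbitSet r i) : orbitOf r x = i :=
  MulAction.orbitRel.Quotient.mem_orbit.1 hx

lemma mem_orbitSet_iff {i : Orbits r} {x : X} : x ∈ orbitSet r i ↔ orbitOf r x = i :=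
  MulAction.orbitRel.Quotient.mem_orbit

lemma orbitOf_leftAct (hn : Nondegenerate r) (x y : X) :
    orbitOf r (leftAct r x y) = orbitOf r y :=
  Quotient.sound ⟨⟨leftPerm hn x, leftPerm_mem hn x⟩, rfl⟩

/-- The restriction of `ℒ_x` to the orbit `X_i`, as an element of `𝒢_i`. -/
noncomputable def leftRestrict (hn : Nondegenerate r) (x : X) (i : Orbits r) : orbitGroup r i :=
  ⟨(leftPerm hn x).subtypePerm fun y => by
      rw [leftPerm_apply, mem_orbitSet_iff, mem_orbitSet_iff, orbitOf_leftAct hn],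
    Subgroup.subset_closure ⟨x, fun _ => rfl⟩⟩

lemma hasHDegree_leftRestrict (hn : Nondegenerate r) (x : X) :
    HasHDegree r x (leftRestrict hn x) := fun _ _ => rfl

lemma HasHDegree.eq {x : X} {g : HGroup r} (hn : Nondegenerate r) (h : HasHDegree r x g) :
    g = leftRestrict hn x :=
  funext fun j => Subtype.ext <| Equiv.ext fun y => Subtype.ext (h j y)

lemma leftRestrict_congr (hn : Nondegenerate r) {x y : X} (h : leftAct r x = leftAct r y) :
    leftRestrict hn x = leftRestrict hn y :=
  HasHDegree.eq hn fun _ z => congrFun h z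

lemma leftAct_eq_of_orbitOf_eq (hL : ∀ x y, leftAct r (leftAct r x y) = leftAct r y) {x y : X}
    (h : orbitOf r x = orbitOf r y) : leftAct r x = leftAct r y := by
  obtain ⟨⟨g, hg⟩, rfl⟩ := Quotient.exact h
  change leftAct r (g y) = leftAct r y
  clear h
  induction hg using Subgroup.closure_induction generalizing y with
  | mem g hg => obtain ⟨x, hx⟩ := hg; rw [hx, hL]
  | one => rfl
  | mul g g' _ _ h h' => rw [Equiv.Perm.mul_apply, h, h']
  | inv g _ h => simpa using (h (y := g⁻¹ y)).symm

lemma hAct_coe (h : HGroup r) {i : Orbits r} (y : orbitSet r i) :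
    hAct r h y = ((h i : Equiv.Perm (orbitSet r i)) y : orbitSet r i) := by
  obtain ⟨y, hy⟩ := y
  obtain rfl := orbitOf_eq_of_mem hy
  rfl

lemma orbitOf_hAct (h : HGroup r) (x : X) : orbitOf r (hAct r h x) = orbitOf r x :=
  orbitOf_eq_of_mem (Subtype.coe_prop _)

lemma hAct_one (x : X) : hAct r 1 x = x := rfl

lemma hAct_mul (g h : HGroup r) (x : X) : hAct r (g * h) x = hAct r g (hAct r h x) :=
  (hAct_coe g _).symm

/-- Involutivity gives `ℒ_{ˣy}(xʸ) = x`, and `ℒ_{ˣy} = ℒ_y`. Thus `xʸ = ℒ_y⁻¹ x`. -/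
lemma leftAct_rightAct (hs : Symmetric r)
    (hL : ∀ x y, leftAct r (leftAct r x y) = leftAct r y) (x y : X) :
    leftAct r y (rightAct r y x) = x := by
  rw [← hL x y, leftAct_invol hs.2]

/-- In the braid identity `ℒ_x ℒ_y = ℒ_{ˣy} ℒ_{xʸ}`, the indices `ˣy` and `xʸ` lie in the orbits of
`y` and `x`. -/
lemma leftAct_comm (hs : Symmetric r) (hL : ∀ x y, leftAct r (leftAct r x y) = leftAct r y)
    (x y z : X) : leftAct r x (leftAct r y z) = leftAct r y (leftAct r x z) := by
  have h : leftAct r (rightAct r y x) = leftAct r x := by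
    rw [← hL y, leftAct_rightAct hs hL]
  rw [leftAct_comp hs.1, hL, h]

lemma orbitGroup_mul_comm (hs : Symmetric r)
    (hL : ∀ x y, leftAct r (leftAct r x y) = leftAct r y) (i : Orbits r) (g h : orbitGroup r i) :
    g * h = h * g := by
  have := Subgroup.isMulCommutative_closure (k := {g : Equiv.Perm (orbitSet r i) |
      ∃ x : X, ∀ y : orbitSet r i, (g y : X) = leftAct r x y}) (by
    rintro a ⟨x, hx⟩ b ⟨y, hy⟩
    refine Equiv.ext fun z => Subtype.ext ?_
    rw [Equiv.Perm.mul_apply, Equiv.Perm.mul_apply, hx, hy, hy, hx, leftAct_comm hs hL])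
  exact this.is_comm.comm g h

/-- For a square-free solution of level two, `𝒢_i` is commutative. -/
abbrev orbitCommGroup (hs : Symmetric r)
    (hL : ∀ x y, leftAct r (leftAct r x y) = leftAct r y) (i : Orbits r) :
    CommGroup (orbitGroup r i) :=
  { (inferInstance : Group (orbitGroup r i)) with mul_comm := orbitGroup_mul_comm hs hL i }

/-- For a square-free solution of level two, `ℋ` is commutative. -/
abbrev hCommGroup (hs : Symmetric r) (hL : ∀ x y, leftAct r (leftAct r x y) = leftAct r y) :
    CommGroup (HGroup r) :=
  { (inferInstance : Group (HGroup r)) with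
    mul_comm := fun g h => funext fun i => orbitGroup_mul_comm hs hL i (g i) (h i) }

end LevelTwo

/-! ### Characters and homogeneous components -/

section Components

variable {X : Type u} {r : X × X → X × X}

lemma pairing_one_left (g : HGroup r) : pairing r 1 g = 1 := by simp [pairing]

lemma pairing_one_right (χ : HDual r) : pairing r χ 1 = 1 := by simp [pairing]

open Classical in
lemma pairing_mulSingle_left (i : Orbits r) (φ : orbitGroup r i →* ℂˣ) (g : HGroup r) :
    pairing r (Pi.mulSingle i φ) g = φ (g i) := by
  rw [pairing, finprod_eq_single _ i]
  · simp
  · intro j hj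
    rw [Pi.mulSingle_eq_of_ne hj, MonoidHom.one_apply]

open Classical in
lemma pairing_mulSingle_right (χ : HDual r) (i : Orbits r) (g : orbitGroup r i) :
    pairing r χ (Pi.mulSingle i g) = χ i g := by
  rw [pairing, finprod_eq_single _ i]
  · simp
  · intro j hj
    rw [Pi.mulSingle_eq_of_ne hj, map_one]

lemma pairing_injective {χ χ' : HDual r} (h : ∀ g, pairing r χ g = pairing r χ' g) : χ = χ' := by
  classical
  refine funext fun i => MonoidHom.ext fun g => ?_
  rw [← pairing_mulSingle_right, h, pairing_mulSingle_right]

variable [Finite X]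

lemma pairing_mul_left (χ χ' : HDual r) (g : HGroup r) :
    pairing r (χ * χ') g = pairing r χ g * pairing r χ' g :=
  finprod_mul_distrib (Set.toFinite _) (Set.toFinite _)

lemma pairing_mul_right (χ : HDual r) (g g' : HGroup r) :
    pairing r χ (g * g') = pairing r χ g * pairing r χ g' := by
  simp only [pairing, Pi.mul_apply, map_mul]
  exact finprod_mul_distrib (Set.toFinite _) (Set.toFinite _)

/-- `ℱ` is multiplicative in each argument, and bicharacters are 2-cocycles. -/
lemma isTwoCocycle_cocycle : IsTwoCocycle (cocycle r) := by
  refine ⟨fun a b c => ?_, fun a => pairing_one_right a.1⟩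
  simp only [cocycle, Prod.fst_mul, Prod.snd_mul, pairing_mul_left, pairing_mul_right]
  exact mul_assoc _ _ _

end Components

end YangBaxter

namespace YangBaxter

/-! ### The `H`-grading of `ℂ[V]`: spanning and independence -/

section Grading

variable {X : Type u} {r : X × X → X × X}

lemma hAct_congr {g h : HGroup r} {x : X} (e : g (orbitOf r x) = h (orbitOf r x)) :
    hAct r g x = hAct r h x := by
  rw [hAct, hAct, e]

lemma leftAct_hAct (hL : ∀ x y, leftAct r (leftAct r x y) = leftAct r y) (h : HGroup r) (x : X) :
    leftAct r (hAct r h x) = leftAct r x :=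
  leftAct_eq_of_orbitOf_eq hL (orbitOf_hAct h x)

/-- The action of `ℋ` on `X`. -/
abbrev hMulAction (r : X × X → X × X) : MulAction (HGroup r) X where
  smul := hAct r
  one_smul := hAct_one
  mul_smul := hAct_mul

@[simp] lemma linForm_single (x : X) (c : ℂ) :
    linForm (Finsupp.single x c) = c • (MvPolynomial.X x : MvPolynomial X ℂ) := by
  simp [linForm]

lemma linForm_mem_component {a : GradingGroup r} {v : X →₀ ℂ} (hv : v ∈ vComponent r a) :
    linForm v ∈ component r a := by
  have h := IsHomogProd.mul a 1 v 1 hv IsHomogProd.one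
  rw [show a * 1 = a from mul_one a, mul_one] at h
  exact Submodule.subset_span h

lemma IsHomogProd.mul_mul {a b : GradingGroup r} {f g : MvPolynomial X ℂ}
    (hf : IsHomogProd r a f) (hg : IsHomogProd r b g) : IsHomogProd r (a * b) (f * g) := by
  induction hf with
  | one => rwa [show 1 * b = b from one_mul b, one_mul]
  | mul a c v f hv _ ih =>
    rw [show a * c * b = a * (c * b) from mul_assoc a c b, mul_assoc]
    exact .mul a (c * b) v _ hv ih

lemma one_mem_component : (1 : MvPolynomial X ℂ) ∈ component r 1 :=
  Submodule.subset_span IsHomogProd.one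

lemma mul_mem_component {a b : GradingGroup r} {f g : MvPolynomial X ℂ}
    (hf : f ∈ component r a) (hg : g ∈ component r b) : f * g ∈ component r (a * b) := by
  have h := Submodule.mul_mem_mul hf hg
  rw [component, component, Submodule.span_mul_span] at h
  refine Submodule.span_mono ?_ h
  rintro _ ⟨f, hf, g, hg, rfl⟩
  exact IsHomogProd.mul_mul hf hg

open Classical in
/-- The projection of the basis vector `x` to the isotypic component of the character `φ` of the
group `𝒢_i` of the orbit of `x`, up to a scalar. -/
noncomputable def isotypicVector [Finite X] (x : X) (φ : orbitGroup r (orbitOf r x) →* ℂˣ) :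
    X →₀ ℂ :=
  haveI := Fintype.ofFinite (orbitGroup r (orbitOf r x))
  ∑ h : orbitGroup r (orbitOf r x),
    Finsupp.single (hAct r (Pi.mulSingle (orbitOf r x) h) x) (φ h⁻¹ : ℂ)

open Classical in
lemma isotypicVector_mem [Finite X] (hn : Nondegenerate r)
    (hL : ∀ x y, leftAct r (leftAct r x y) = leftAct r y) (x : X)
    (φ : orbitGroup r (orbitOf r x) →* ℂˣ) :
    isotypicVector x φ ∈ vComponent r (Pi.mulSingle (orbitOf r x) φ, leftRestrict hn x) := by
  let _ := Fintype.ofFinite (orbitGroup r (orbitOf r x))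
  refine ⟨?_, fun g => ?_⟩
  · refine Submodule.sum_mem _ fun h _ => ?_
    rw [← mul_one (φ h⁻¹ : ℂ), ← smul_eq_mul, ← Finsupp.smul_single]
    refine Submodule.smul_mem _ _ (Submodule.subset_span ⟨_, fun j y => ?_, rfl⟩)
    rw [leftAct_hAct hL]
    exact hasHDegree_leftRestrict hn x j y
  · rw [pairing_mulSingle_left, isotypicVector, map_sum, Finset.smul_sum]
    -- Only the component of `g` at the orbit of `x` moves the points involved; translating the
    -- summation index by it extracts the factor `φ`.
    refine Fintype.sum_equiv (M := X →₀ ℂ) (Equiv.mulLeft (g (orbitOf r x))) _ _ fun h => ?_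
    rw [Finsupp.lmapDomain_apply, Finsupp.mapDomain_single, Finsupp.smul_single, ← hAct_mul]
    congr 1
    · apply hAct_congr
      simp
    · simp [mul_left_comm _ ((φ h : ℂ)⁻¹)]

/-- After exchanging the sums, orthogonality over the commutative group `𝒢_i` leaves only the term
`h = 1`. -/
lemma sum_isotypicVector [Finite X] (hs : Symmetric r)
    (hL : ∀ x y, leftAct r (leftAct r x y) = leftAct r y) (x : X)
    [Fintype (orbitGroup r (orbitOf r x) →* ℂˣ)] :
    ∑ φ : orbitGroup r (orbitOf r x) →* ℂˣ, isotypicVector x φ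
      = Finsupp.single x (Fintype.card (orbitGroup r (orbitOf r x) →* ℂˣ) : ℂ) := by
  classical
  let _ := orbitCommGroup hs hL (orbitOf r x)
  let _ := Fintype.ofFinite (orbitGroup r (orbitOf r x))
  simp only [isotypicVector]
  rw [Finset.sum_comm]
  have key : ∀ h : orbitGroup r (orbitOf r x), ∑ φ : orbitGroup r (orbitOf r x) →* ℂˣ,
      (φ h⁻¹ : ℂ) = if h = 1 then
        (Fintype.card (orbitGroup r (orbitOf r x) →* ℂˣ) : ℂ) else 0 := fun h => by
    rw [sum_characters_apply]
    simp only [inv_eq_one]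
  simp only [← Finsupp.single_finsetSum]
  rw [Finset.sum_eq_single 1]
  · rw [key, if_pos rfl, Pi.mulSingle_one, hAct_one]
  · intro h _ hh
    rw [key, if_neg hh, Finsupp.single_zero]
  · simp

lemma X_mem_iSup_component [Finite X] (hn : Nondegenerate r) (hs : Symmetric r)
    (hL : ∀ x y, leftAct r (leftAct r x y) = leftAct r y) (x : X) :
    (MvPolynomial.X x : MvPolynomial X ℂ) ∈ ⨆ a, component r a := by
  classical
  let _ := orbitCommGroup hs hL (orbitOf r x)
  have := Fintype.ofFinite (orbitGroup r (orbitOf r x) →* ℂˣ)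
  have h := congrArg linForm (sum_isotypicVector hs hL x)
  rw [map_sum, linForm_single] at h
  have hN : (Fintype.card (orbitGroup r (orbitOf r x) →* ℂˣ) : ℂ) ≠ 0 :=
    Nat.cast_ne_zero.2 Fintype.card_ne_zero
  refine (Submodule.smul_mem_iff _ hN).1 (h ▸ Submodule.sum_mem _ fun φ _ => ?_)
  exact Submodule.mem_iSup_of_mem _ (linForm_mem_component (isotypicVector_mem hn hL x φ))

lemma iSup_component [Finite X] (hn : Nondegenerate r) (hs : Symmetric r)
    (hL : ∀ x y, leftAct r (leftAct r x y) = leftAct r y) : ⨆ a, component r a = ⊤ := by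
  have hmul : ∀ f ∈ ⨆ a, component r a, ∀ g ∈ ⨆ a, component r a,
      f * g ∈ ⨆ a, component r a := by
    intro f hf g hg
    induction hf using Submodule.iSup_induction' with
    | zero => simp
    | add f f' _ _ h h' => rw [add_mul]; exact add_mem h h'
    | mem a f hf =>
      induction hg using Submodule.iSup_induction' with
      | zero => simp
      | add f f' _ _ h h' => rw [mul_add]; exact add_mem h h'
      | mem b g hg => exact Submodule.mem_iSup_of_mem _ (mul_mem_component hf hg)
  rw [eq_top_iff, ← span_range_mon, Submodule.span_le]
  rintro _ ⟨s, rfl⟩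
  induction s using Multiset.induction_on with
  | empty => rw [mon_zero]; exact Submodule.mem_iSup_of_mem 1 one_mem_component
  | cons x s ih => rw [mon_cons]; exact hmul _ (X_mem_iSup_component hn hs hL x) _ ih

lemma mem_degSpan_of_mem_component (hn : Nondegenerate r) (hs : Symmetric r)
    (hL : ∀ x y, leftAct r (leftAct r x y) = leftAct r y) {a : GradingGroup r}
    {f : MvPolynomial X ℂ} (hf : f ∈ component r a) :
    letI := hCommGroup hs hL
    f ∈ degSpan ℂ (leftRestrict hn) a.2 := by
  let _ := hCommGroup hs hL
  refine Submodule.span_le.2 (fun f (h : IsHomogProd r a f) => ?_) hf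
  clear hf
  induction h with
  | one => exact one_mem_degSpan _
  | mul a b v f hv _ ih =>
    refine mul_mem_degSpan _ ?_ ih
    have h := Submodule.mem_map_of_mem (f := linForm) hv.1
    rw [Submodule.map_span] at h
    refine Submodule.span_mono ?_ h
    rintro _ ⟨_, ⟨x, hx, rfl⟩, rfl⟩
    refine ⟨{x}, ?_, by simp⟩
    exact (monDeg_singleton _ x).trans (HasHDegree.eq hn hx).symm

/-- The eigenvalue property passes from linear forms to products, since `ρ_h` is an algebra map and
the pairing is multiplicative in the character. -/
lemma permVars_of_mem_component [Finite X] (hs : Symmetric r)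
    (hL : ∀ x y, leftAct r (leftAct r x y) = leftAct r y) {a : GradingGroup r}
    {f : MvPolynomial X ℂ} (hf : f ∈ component r a) (h : HGroup r) :
    letI := hCommGroup hs hL
    letI := hMulAction r
    permVars ℂ h f = (pairing r a.1 h : ℂ) • f := by
  let _ := hCommGroup hs hL
  let _ := hMulAction r
  have hlin : ∀ v : X →₀ ℂ,
      permVars ℂ h (linForm v) = linForm (Finsupp.lmapDomain ℂ ℂ (hAct r h) v) := by
    intro v
    induction v using Finsupp.induction_linear with
    | zero => simp
    | add v w hv hw => simp only [map_add, hv, hw]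
    | single x c =>
      rw [Finsupp.lmapDomain_apply, Finsupp.mapDomain_single, linForm_single, linForm_single,
        map_smul, permVars_X]
      rfl
  change permVars ℂ h f = (pairing r a.1 h : ℂ) • f
  induction hf using Submodule.span_induction with
  | zero => simp
  | add f g _ _ hf hg => rw [map_add, hf, hg, smul_add]
  | smul c f _ hf => rw [map_smul, hf, smul_comm]
  | mem f hf =>
    induction hf with
    | one => simp [pairing_one_left]
    | mul a b v f hv _ ih =>
      rw [map_mul, ih, hlin, hv.2 h, map_smul, Prod.fst_mul, pairing_mul_left, Units.val_mul,
        smul_mul_smul_comm]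

/-- The eigenvalues determine the degree: those of the `ρ_h` recover `χ`, those of the projections
recover `g`. -/
lemma iSupIndep_component [Finite X] (hn : Nondegenerate r) (hs : Symmetric r)
    (hL : ∀ x y, leftAct r (leftAct r x y) = leftAct r y) : iSupIndep (component r) := by
  classical
  let _ := hCommGroup hs hL
  let _ := hMulAction r
  have hγ : ∀ (g : HGroup r) (x : X), leftRestrict hn (g • x) = leftRestrict hn x :=
    fun g x => leftRestrict_congr hn (leftAct_hAct hL g x)
  refine iSupIndep_of_commuting_eigenvectors
    (Sum.elim (fun h => (permVars ℂ h).toLinearMap) (degProj ℂ (leftRestrict hn)))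
    ?_ (fun a => Sum.elim (fun h => (pairing r a.1 h : ℂ)) fun g => if a.2 = g then 1 else 0)
    ?_ _ ?_
  · rintro (g | g) (h | h)
    · exact commute_permVars g h
    · exact commute_permVars_degProj hγ g h
    · exact (commute_permVars_degProj hγ h g).symm
    · exact commute_degProj _ g h
  · intro a b hab
    refine Prod.ext (pairing_injective fun g => ?_) ?_
    · exact Units.ext (congrFun hab (Sum.inl g))
    · have := congrFun hab (Sum.inr b.2)
      simpa using this
  · rintro a f hf (h | h)
    · exact permVars_of_mem_component hs hL hf h
    · simpa using degProj_of_mem_degSpan h (mem_degSpan_of_mem_component hn hs hL hf)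

lemma isGroupGrading_component [Finite X] (hn : Nondegenerate r) (hs : Symmetric r)
    (hL : ∀ x y, leftAct r (leftAct r x y) = leftAct r y) : IsGroupGrading (component r) where
  indep := iSupIndep_component hn hs hL
  span := iSup_component hn hs hL
  one_mem := one_mem_component
  mul_mem _ _ _ _ := mul_mem_component

end Grading

/-- The cotwisted product is determined on homogeneous elements. -/
lemma IsCotwist.unique {H A : Type u} [Group H] [Ring A] [Algebra ℂ A] {𝒜 : H → Submodule ℂ A}
    (hspan : ⨆ a, 𝒜 a = ⊤) {F : H → H → ℂˣ} {B B' : A →ₗ[ℂ] A →ₗ[ℂ] A} (hB : IsCotwist 𝒜 F B)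
    (hB' : IsCotwist 𝒜 F B') : B = B' := by
  refine LinearMap.ext₂ fun f g => ?_
  have hf : f ∈ ⨆ a, 𝒜 a := hspan ▸ Submodule.mem_top
  have hg : g ∈ ⨆ a, 𝒜 a := hspan ▸ Submodule.mem_top
  induction hf using Submodule.iSup_induction' with
  | zero => simp
  | add f f' _ _ h h' => simp only [map_add, LinearMap.add_apply, h, h']
  | mem a f hf =>
    induction hg using Submodule.iSup_induction' with
    | zero => simp
    | add f f' _ _ h h' => simp only [map_add, h, h']
    | mem b g hg => rw [hB a b f g hf hg, hB' a b f g hf hg]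

end YangBaxter

theorem corollary6p5 {X : Type u} [Finite X] (r : X × X → X × X)
    (hnondeg : YangBaxter.Nondegenerate r) (hsqfree : YangBaxter.SquareFree r)
    (hsymm : YangBaxter.Symmetric r) (hlevel : YangBaxter.HasLevel r 2) :
    YangBaxter.IsGroupGrading (YangBaxter.component r) ∧
    YangBaxter.IsTwoCocycle (YangBaxter.cocycle r) ∧
    ∃ B : MvPolynomial X ℂ →ₗ[ℂ] MvPolynomial X ℂ →ₗ[ℂ] MvPolynomial X ℂ,
      YangBaxter.IsCotwist (YangBaxter.component r) (YangBaxter.cocycle r) B ∧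
      (∀ B', YangBaxter.IsCotwist (YangBaxter.component r) (YangBaxter.cocycle r) B' → B' = B) ∧
      (∀ f g h, B (B f g) h = B f (B g h)) ∧
      (∀ f, B 1 f = f ∧ B f 1 = f) ∧
      (∀ x y : X, B (MvPolynomial.X x) (MvPolynomial.X y)
        = MvPolynomial.X x * MvPolynomial.X (YangBaxter.leftAct r x y)) ∧
      ∃ φ : YangBaxter.Alg ℂ r ≃ₗ[ℂ] MvPolynomial X ℂ,
        φ 1 = 1 ∧ (∀ a b, φ (a * b) = B (φ a) (φ b)) ∧
        ∀ x : X, φ (YangBaxter.Alg.gen ℂ r x) = MvPolynomial.X x := by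
  open YangBaxter in
  have hL := leftAct_leftAct_of_hasLevel hnondeg hsqfree hsymm hlevel
  let _ := hCommGroup hsymm hL
  let _ := hMulAction r
  have hγ : ∀ (g : HGroup r) (x : X), leftRestrict hnondeg (g • x) = leftRestrict hnondeg x :=
    fun g x => leftRestrict_congr hnondeg (leftAct_hAct hL g x)
  have hr : ∀ x y, r (x, y)
      = (leftRestrict hnondeg x • y, (leftRestrict hnondeg y)⁻¹ • x) := fun x y =>
    Prod.ext rfl (eq_inv_smul_iff.2 (leftAct_rightAct hsymm hL x y))
  have hgr := isGroupGrading_component hnondeg hsymm hL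
  have hB : IsCotwist (component r) (cocycle r) (cotwistMul ℂ (leftRestrict hnondeg)) := by
    intro a b f g hf hg
    -- `f` contributes only its `ℋ`-degree `a.2`, and `ρ_{a.2}` scales `g` by `b.1(a.2) = ℱ(a, b)`.
    rw [cotwistMul_of_mem_degSpan (mem_degSpan_of_mem_component hnondeg hsymm hL hf),
      permVars_of_mem_component hsymm hL hg, mul_smul_comm]
    rfl
  refine ⟨hgr, isTwoCocycle_cocycle, cotwistMul ℂ (leftRestrict hnondeg), hB,
    fun B' hB' => hB'.unique hgr.span hB, cotwistMul_assoc hγ,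
    fun f => ⟨cotwistMul_one_left _ f, cotwistMul_one_right _ f⟩, fun x y => ?_,
    Alg.polyEquiv hγ hr, ?_, fun a b => Alg.toPoly_mul hγ hr a b, fun x => ?_⟩
  · rw [cotwistMul_X, permVars_X]
    rfl
  · rw [Alg.polyEquiv_apply, Alg.toPoly_apply, map_one (Alg.toEnd hγ hr)]
    rfl
  · rw [Alg.polyEquiv_apply, Alg.toPoly_apply, Alg.toEnd_gen, cotwistMul_one_right]
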